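/- Let $M$ be a compact connected (Hausdorff) smooth manifold, possibly with boundary, whose first integral singular homology $H_1(M;\mathbb Z)$ is free of finite rank $b$; fix a basis, so that $H_1(M;\mathbb Z)\cong\mathbb Z^b$. Let $f:M\to M$ be continuous and let $A$ be the $b\times b$ integer matrix of $f_*:H_1(M;\mathbb Z)\to H_1(M;\mathbb Z)$. Let $\pi:\tilde M_a\to M$ be the universal Abelian cover of $M$, i.e. the quotient of the universal cover by the commutator subgroup of the fundamental group. Its deck group is $\mathbb Z^b$: if the universal cover is described as the set of homotopy classes $[\alpha]$ of paths starting at a base point $x_0$, then the deck transformation $\delta_{\vec n}$ is induced by $[\alpha]\mapsto[\ell\cdot\alpha]$ for any loop $\ell$ at $x_0$ with homology class $\vec n$. A lift of $f$ is a continuous map $\tilde f:\tilde M_a\to\tilde M_a$ with $\pi\circ\tilde f=f\circ\pi$. For a fixed point $x$ of $f$ and a lift $\tilde f$, the displacement of $x$ is $$D(x,\tilde f)=\vec n+(A-I)\mathbb Z^b\ \in\ \mathrm{BF}_1(f)=\mathbb Z^b/(A-I)\mathbb Z^b ,$$ where $\tilde f(\tilde x)=\delta_{\vec n}\tilde x$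 for any $\tilde x\in\pi^{-1}(x)$; it does not depend on the choice of $\tilde x$. Then for fixed points $x,x'$ of $f$ the following are equivalent. (1) $D(x,\tilde f)=D(x',\tilde f)$ for some lift $\tilde f$ of $f$. (2) There are a lift $\tilde f$ of $f$ and points $\tilde x\in\pi^{-1}(x)$, $\tilde x'\in\pi^{-1}(x')$ with $\tilde f(\tilde x)=\tilde x$ and $\tilde f(\tilde x')=\tilde x'$. (3) There is a path $\gamma:[0,1]\to M$ from $x$ to $x'$ that is homologous to $f\circ\gamma$ rel endpoints, i.e. the singular $1$-chain $f\circ\gamma-\gamma$ is the boundary of an integral singular $2$-chain. -/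

import Mathlib

open scoped ContDiff Manifold

universe u

namespace AbelianDisplacement

noncomputable section

open CategoryTheory AlgebraicTopology

section Homology

/-- The integral singular chain complex of the space `M`
(`ULift ℤ` is the group `ℤ`, placed in the universe of `M`). -/
abbrev singularChains (M : Type u) [TopologicalSpace M] : ChainComplex (ModuleCat.{u} ℤ) ℕ :=
  ((singularChainComplexFunctor (ModuleCat.{u} ℤ)).obj (ModuleCat.of ℤ (ULift.{u} ℤ))).obj
    (TopCat.of M)

/-- The first integral singular homology group `H₁(M; ℤ)`. -/
abbrev H1 (M : Type u) [TopologicalSpace M] : ModuleCat.{u} ℤ :=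
  ((singularHomologyFunctor (ModuleCat.{u} ℤ) 1).obj (ModuleCat.of ℤ (ULift.{u} ℤ))).obj
    (TopCat.of M)

/-- The map `f_* : H₁(M; ℤ) → H₁(M; ℤ)` induced by a continuous map. -/
def H1map {M : Type u} [TopologicalSpace M] (f : C(M, M)) : H1 M →ₗ[ℤ] H1 M :=
  (((singularHomologyFunctor (ModuleCat.{u} ℤ) 1).obj (ModuleCat.of ℤ (ULift.{u} ℤ))).map
    (TopCat.ofHom f)).hom

variable {M : Type u} [TopologicalSpace M]

/-- A path, seen as a singular 1-simplex: `(s₀, s₁) ↦ γ s₁`. -/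
def pathSimplex {x y : M} (γ : Path x y) :
    (TopCat.toSSet.obj (TopCat.of M)).obj (.op (.mk 1)) :=
  (TopCat.toSSetObjEquiv (TopCat.of M) (.op (.mk 1))).symm
    (γ.toContinuousMap.comp
      ⟨stdSimplexHomeomorphUnitInterval, stdSimplexHomeomorphUnitInterval.continuous⟩)

/-- A path, seen as a singular 1-chain (its simplex with coefficient one). -/
def pathChain {x y : M} (γ : Path x y) : (singularChains M).X 1 :=
  (SSet.ιChainComplex (TopCat.toSSet.obj (TopCat.of M))
    (R := ModuleCat.of ℤ (ULift.{u} ℤ)) (pathSimplex γ)).hom (ULift.up 1)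

/-- Two paths with the same endpoints are homologous rel endpoints: their difference is the
boundary of a singular 2-chain. -/
def HomologousRel {x y : M} (γ γ' : Path x y) : Prop :=
  ∃ c : (singularChains M).X 2, ((singularChains M).d 2 1).hom c = pathChain γ' - pathChain γ

/-- `h ∈ H₁(M; ℤ)` is the homology class of the loop `l`, i.e. of the singular cycle
given by `l`. -/
def IsHomologyClass {x : M} (l : Path x x) (h : H1 M) : Prop :=
  ∃ z : (singularChains M).cycles 1,
    ((singularChains M).iCycles 1).hom z = pathChain l ∧ ((singularChains M).homologyπ 1).hom z = h

end Homology

section Cover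

/-- The points of the universal cover of `M` with base point `x₀`: homotopy classes rel endpoints
of paths in `M` starting at `x₀`. -/
structure UniversalCover {M : Type u} [TopologicalSpace M] (x₀ : M) where
  /-- the endpoint, that is, the projection to `M` -/
  endpoint : M
  /-- the class of paths -/
  cls : Path.Homotopic.Quotient x₀ endpoint

variable {M : Type u} [TopologicalSpace M] {x₀ : M}

/-- For `a = [α]` and `U ⊆ M`, the set of all classes `[α · η]`, where `η` is a path in `U`
that starts at the endpoint of `α`. -/
def UniversalCover.sheet (a : UniversalCover x₀) (U : Set M) : Set (UniversalCover x₀) :=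
  {b | ∃ η : Path a.endpoint b.endpoint, (∀ t, η t ∈ U) ∧
    b.cls = a.cls.trans (Path.Homotopic.Quotient.mk η)}

/-- The usual topology of the universal cover, with basis the sets `a.sheet U` for `U` open. -/
instance : TopologicalSpace (UniversalCover x₀) :=
  TopologicalSpace.generateFrom
    {V | ∃ (a : UniversalCover x₀) (U : Set M), IsOpen U ∧ a.endpoint ∈ U ∧ V = a.sheet U}

/-- The action of the class of a loop at `x₀` on the universal cover: `[α] ↦ [l · α]`. -/
def UniversalCover.act (l : FundamentalGroup M x₀) (a : UniversalCover x₀) : UniversalCover x₀ :=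
  ⟨a.endpoint, l.toPath.trans a.cls⟩

theorem UniversalCover.act_act (k l : FundamentalGroup M x₀) (a : UniversalCover x₀) :
    act k (act l a) = act (l * k) a := by
  simp only [act, FundamentalGroup.mul_def, FundamentalGroup.toPath, FundamentalGroup.toArrow,
    Path.Homotopic.Quotient.trans_assoc]

theorem UniversalCover.act_one (a : UniversalCover x₀) : act 1 a = a := by
  simp only [act, FundamentalGroup.one_def, FundamentalGroup.toPath, FundamentalGroup.toArrow,
    Path.Homotopic.Quotient.refl_trans]

/-- Two points of the universal cover are identified when they lie in one orbit of the
commutator subgroup of the fundamental group. -/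
def commutatorSetoid (x₀ : M) : Setoid (UniversalCover x₀) where
  r a b := ∃ l ∈ commutator (FundamentalGroup M x₀), b = UniversalCover.act l a
  iseqv :=
    { refl := fun a => ⟨1, one_mem _, (UniversalCover.act_one a).symm⟩
      symm := by
        rintro a b ⟨l, hl, rfl⟩
        exact ⟨l⁻¹, inv_mem hl, by
          rw [UniversalCover.act_act, mul_inv_cancel, UniversalCover.act_one]⟩
      trans := by
        rintro a b c ⟨l, hl, rfl⟩ ⟨k, hk, rfl⟩
        exact ⟨l * k, mul_mem hl hk, UniversalCover.act_act k l a⟩ }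

/-- The universal Abelian cover of `M`: the quotient of the universal cover by the action of the
commutator subgroup of the fundamental group. -/
def AbelianCover (x₀ : M) : Type u := Quotient (commutatorSetoid x₀)

instance : TopologicalSpace (AbelianCover x₀) :=
  inferInstanceAs (TopologicalSpace (Quotient (commutatorSetoid x₀)))

/-- The projection of the universal Abelian cover to `M`. -/
def AbelianCover.proj (e : AbelianCover x₀) : M :=
  Quotient.lift (s := commutatorSetoid x₀) UniversalCover.endpoint
    (by rintro a b ⟨l, -, rfl⟩; rfl) e

/-- The deck transformation `[α] ↦ [l · α]` of the universal Abelian cover given by the class of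
a loop `l` at `x₀`. -/
def AbelianCover.deck (l : FundamentalGroup M x₀) : AbelianCover x₀ → AbelianCover x₀ :=
  Quotient.map' (s₁ := commutatorSetoid x₀) (s₂ := commutatorSetoid x₀) (UniversalCover.act l) (by
    rintro a b ⟨k, hk, rfl⟩
    refine ⟨l⁻¹ * k * l, ?_, ?_⟩
    · have : (commutator (FundamentalGroup M x₀)).Normal := inferInstance
      simpa using this.conj_mem k hk l⁻¹
    · rw [UniversalCover.act_act, UniversalCover.act_act]
      congr 1
      group)

/-- `F` is a lift of `f` to the universal Abelian cover. -/
def IsLift (f : C(M, M)) (F : C(AbelianCover x₀, AbelianCover x₀)) : Prop :=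
  ∀ e, (F e).proj = f e.proj

end Cover

section Displacement

variable {M : Type u} [TopologicalSpace M] {b : ℕ} (Γ : Module.Basis (Fin b) ℤ (H1 M))

/-- `δ` is the deck transformation `δ_n` of the universal Abelian cover that corresponds to
`n ∈ ℤ^b ≅ H₁(M; ℤ)`: it is given by a loop with homology class `∑ i, n i • Γ i`. -/
def IsDeckTransformation {x₀ : M} (n : Fin b → ℤ) (δ : AbelianCover x₀ → AbelianCover x₀) : Prop :=
  ∃ l : Path x₀ x₀, IsHomologyClass l (∑ i, n i • Γ i) ∧
    δ = AbelianCover.deck (FundamentalGroup.fromPath (Path.Homotopic.Quotient.mk l))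

/-- The integer matrix `A` of `f_* : H₁(M; ℤ) → H₁(M; ℤ)` in the basis `Γ`. -/
def homologyMatrix (f : C(M, M)) : Matrix (Fin b) (Fin b) ℤ :=
  LinearMap.toMatrix Γ Γ (H1map f)

/-- The subgroup `(A - I) ℤ^b` of `ℤ^b`. -/
def imageAsubI (f : C(M, M)) : Submodule ℤ (Fin b → ℤ) :=
  LinearMap.range (homologyMatrix Γ f - 1).mulVecLin

/-- The Bowen-Franks group `BF₁(f) = ℤ^b / (A - I) ℤ^b`. -/
abbrev BF1 (f : C(M, M)) : Type := (Fin b → ℤ) ⧸ imageAsubI Γ f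

/-- `d ∈ BF₁(f)` is the displacement `D(x, F)` of the fixed point `x` of `f` under the lift `F`:
for any lift `e` of `x` one has `F e = δ_n e` for some `n` that represents `d`. -/
def IsDisplacement (f : C(M, M)) {x₀ : M} (F : C(AbelianCover x₀, AbelianCover x₀)) (x : M)
    (d : BF1 Γ f) : Prop :=
  ∀ e : AbelianCover x₀, e.proj = x →
    ∃ (n : Fin b → ℤ) (δ : AbelianCover x₀ → AbelianCover x₀),
      IsDeckTransformation Γ n δ ∧ F e = δ e ∧ (imageAsubI Γ f).mkQ n = d

end Displacement

end

end AbelianDisplacement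

/-!
The class of a path in the group `C₁ / B₁` of singular 1-chains modulo boundaries is additive under
concatenation and invariant under homotopy. By the Hurewicz theorem the kernel of this class on
loops at `x₀` is the commutator subgroup, so a point `e = [α]` of the universal Abelian cover is
determined by its projection and the class of `α` in `C₁ / B₁`, its *fibre class*. Moving `e` by the
deck transformation `δ_n` adds `n ∈ H₁ ⊆ C₁ / B₁` to the fibre class, and every lift of `f` has the
form `[α] ↦ [c · f α]`, hence acts on fibre classes as `v ↦ κ + f_* v` with a constant `κ`.

All three conditions thereby become linear equations in `C₁ / B₁`. For lifts `e = [α]` of `x` and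
`e' = [α · γ]` of `x'`, the failures of `F` to fix `e` and `e'` differ by `f_* [γ] - [γ]`; this
vanishes if and only if `γ` and `f ∘ γ` are homologous, and replacing `γ` by another path from `x`
to `x'` changes it by an element of `(f_* - 1) H₁`.
-/

namespace AbelianDisplacement

noncomputable section

open CategoryTheory AlgebraicTopology

section SingularChains

variable {M N : Type u} [TopologicalSpace M] [TopologicalSpace N] {n : ℕ}

/-- A continuous map on the standard `n`-simplex, seen as a singular chain with coefficient one. -/
def simplexChain (s : C(stdSimplex ℝ (Fin (n + 1)), M)) : (singularChains M).X n :=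
  (SSet.ιChainComplex (TopCat.toSSet.obj (TopCat.of M)) (R := ModuleCat.of ℤ (ULift.{u} ℤ))
    ((TopCat.toSSetObjEquiv (TopCat.of M) (.op (.mk n))).symm s)).hom (ULift.up 1)

theorem pathChain_eq_simplexChain {x y : M} (γ : Path x y) :
    pathChain γ = simplexChain (γ.toContinuousMap.comp
      ⟨stdSimplexHomeomorphUnitInterval, stdSimplexHomeomorphUnitInterval.continuous⟩) :=
  rfl

/-- The affine map between standard simplices given by a map of their vertices. -/
abbrev simplexMap {m n : ℕ} (v : Fin (m + 1) → Fin (n + 1)) :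
    C(stdSimplex ℝ (Fin (m + 1)), stdSimplex ℝ (Fin (n + 1))) :=
  ⟨stdSimplex.map v, stdSimplex.continuous_map v⟩

theorem boundary_simplexChain (s : C(stdSimplex ℝ (Fin (n + 2)), M)) :
    ((singularChains M).d (n + 1) n).hom (simplexChain s) =
      ∑ i : Fin (n + 2), (-1 : ℤ) ^ (i : ℕ) • simplexChain (s.comp (simplexMap i.succAbove)) := by
  have h := congrArg (fun φ => φ.hom (ULift.up (1 : ℤ))) (SSet.ιChainComplex_d
    (R := ModuleCat.of ℤ (ULift.{u} ℤ)) (TopCat.toSSet.obj (TopCat.of M))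
    ((TopCat.toSSetObjEquiv (TopCat.of M) (.op (.mk (n + 1)))).symm s))
  refine h.trans ?_
  simp only [ModuleCat.hom_sum, ModuleCat.hom_smul, LinearMap.sum_apply, LinearMap.smul_apply]
  rfl

/-- The chain map induced by a continuous map. -/
abbrev chainsMap (f : C(M, N)) : singularChains M ⟶ singularChains N :=
  ((singularChainComplexFunctor (ModuleCat.{u} ℤ)).obj (ModuleCat.of ℤ (ULift.{u} ℤ))).map
    (TopCat.ofHom f)

theorem chainsMap_simplexChain (f : C(M, N)) (s : C(stdSimplex ℝ (Fin (n + 1)), M)) :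
    ((chainsMap f).f n).hom (simplexChain s) = simplexChain (f.comp s) := by
  have h := congrArg (fun φ => φ.hom (ULift.up (1 : ℤ)))
    (SSet.ι_chainComplexMap_f _ _ (TopCat.toSSet.map (TopCat.ofHom f))
      (ModuleCat.of ℤ (ULift.{u} ℤ)) ((TopCat.toSSetObjEquiv (TopCat.of M) (.op (.mk n))).symm s))
  exact h

section UniversalProperty

variable {A : Type u} [AddCommGroup A]

theorem addMonoidHom_ext_simplexChain {φ ψ : (singularChains M).X n →+ A}
    (h : ∀ s, φ (simplexChain s) = ψ (simplexChain s)) : φ = ψ := by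
  let linear (χ : (singularChains M).X n →+ A) : (singularChains M).X n ⟶ ModuleCat.of ℤ A :=
    ModuleCat.ofHom { χ with map_smul' := fun k c => map_intCast_smul χ ℤ ℤ k c }
  have heq : linear φ = linear ψ := by
    refine SSet.chainComplex_hom_ext fun σ => ModuleCat.hom_ext ?_
    obtain ⟨s, rfl⟩ := (TopCat.toSSetObjEquiv (TopCat.of M) (.op (.mk n))).symm.surjective σ
    exact (LinearMap.cancel_right ULift.moduleEquiv.symm.surjective).1 (LinearMap.ext_ring (h s))
  ext c
  exact congrArg (fun χ => χ.hom c) heq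

theorem exists_addMonoidHom_simplexChain (g : C(stdSimplex ℝ (Fin (n + 1)), M) → A) :
    ∃ φ : (singularChains M).X n →+ A, ∀ s, φ (simplexChain s) = g s := by
  let X := TopCat.toSSet.obj (TopCat.of M)
  let R := ModuleCat.of ℤ (ULift.{u} ℤ)
  let t (σ : X.obj (.op (.mk n))) : R ⟶ ModuleCat.of ℤ A :=
    ModuleCat.ofHom ((LinearMap.toSpanSingleton ℤ A (g (TopCat.toSSetObjEquiv _ _ σ))).comp
      ULift.moduleEquiv.toLinearMap)
  refine ⟨((X.isColimitChainComplexXCofan R n).desc (Limits.Cofan.mk _ t)).hom.toAddMonoidHom,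
    fun s => ?_⟩
  have h := congrArg (fun φ => φ.hom (ULift.up (1 : ℤ)))
    ((X.isColimitChainComplexXCofan R n).fac (Limits.Cofan.mk _ t)
      ⟨(TopCat.toSSetObjEquiv (TopCat.of M) (.op (.mk n))).symm s⟩)
  refine h.trans ?_
  change LinearMap.toSpanSingleton ℤ A (g _) 1 = g s
  rw [LinearMap.toSpanSingleton_apply_one, Equiv.apply_symm_apply]

end UniversalProperty

/-- A point, seen as a singular 0-chain. -/
def pointChain (x : M) : (singularChains M).X 0 :=
  simplexChain (.const _ x)

theorem boundary_pathChain {x y : M} (γ : Path x y) :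
    ((singularChains M).d 1 0).hom (pathChain γ) = pointChain y - pointChain x := by
  have face (i : Fin 2) : (γ.toContinuousMap.comp ⟨stdSimplexHomeomorphUnitInterval,
      stdSimplexHomeomorphUnitInterval.continuous⟩).comp (simplexMap i.succAbove) =
        .const _ (γ (stdSimplexHomeomorphUnitInterval (stdSimplex.vertex (i.succAbove 0)))) := by
    ext u
    rw [Subsingleton.elim u (stdSimplex.vertex 0)]
    simp
  rw [pathChain_eq_simplexChain, boundary_simplexChain, Fin.sum_univ_two, face, face]
  simp [pointChain, sub_eq_add_neg]

end SingularChains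

section Edges

variable {M : Type u} [TopologicalSpace M] {n : ℕ}

/-- The edge from the `i`-th to the `j`-th vertex of a standard simplex. -/
def edge (i j : Fin (n + 1)) :
    Path (stdSimplex.vertex i : stdSimplex ℝ (Fin (n + 1))) (stdSimplex.vertex j) where
  toFun t := simplexMap ![i, j] (stdSimplexHomeomorphUnitInterval.symm t)
  continuous_toFun := by fun_prop
  source' := by
    rw [← stdSimplexHomeomorphUnitInterval_zero, Homeomorph.symm_apply_apply]
    simp
  target' := by
    rw [← stdSimplexHomeomorphUnitInterval_one, Homeomorph.symm_apply_apply]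
    simp

instance : SimplyConnectedSpace (stdSimplex ℝ (Fin (n + 1))) := by
  have : ContractibleSpace (stdSimplex ℝ (Fin (n + 1))) :=
    (convex_stdSimplex ℝ _).contractibleSpace ⟨_, single_mem_stdSimplex ℝ 0⟩
  infer_instance

theorem sum_map_smul {ι κ E : Type*} [Fintype ι] [Fintype κ] [AddCommGroup E] [Module ℝ E]
    (v : ι → κ) (u : stdSimplex ℝ ι) (w : κ → E) :
    ∑ k, stdSimplex.map v u k • w k = ∑ i, u i • w (v i) := by
  classical
  simp only [stdSimplex.map_coe, FunOnFinite.linearMap_apply_apply, Finset.sum_smul]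
  rw [← Finset.sum_fiberwise Finset.univ v]
  refine Finset.sum_congr rfl fun k _ => Finset.sum_congr rfl fun i hi => ?_
  rw [(Finset.mem_filter.1 hi).2]

theorem sum_edge_smul {E : Type*} [AddCommGroup E] [Module ℝ E] (i j : Fin (n + 1))
    (t : unitInterval) (w : Fin (n + 1) → E) :
    ∑ k, edge i j t k • w k = AffineMap.lineMap (w i) (w j) (t : ℝ) := by
  refine (sum_map_smul ![i, j] _ w).trans ?_
  rw [Fin.sum_univ_two, AffineMap.lineMap_apply_module]
  rfl

theorem pathChain_map_edge (s : C(stdSimplex ℝ (Fin (n + 1)), M)) (i j : Fin (n + 1)) :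
    pathChain ((edge i j).map s.continuous) = simplexChain (s.comp (simplexMap ![i, j])) := by
  rw [pathChain_eq_simplexChain]
  congr 1
  ext u
  simp [edge]

theorem boundary_triangle (s : C(stdSimplex ℝ (Fin 3), M)) :
    ((singularChains M).d 2 1).hom (simplexChain s) =
      pathChain ((edge 0 1).map s.continuous) + pathChain ((edge 1 2).map s.continuous) -
        pathChain ((edge 0 2).map s.continuous) := by
  have h₀ : (0 : Fin 3).succAbove = ![1, 2] := by decide
  have h₁ : (1 : Fin 3).succAbove = ![0, 2] := by decide
  have h₂ : (2 : Fin 3).succAbove = ![0, 1] := by decide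
  rw [boundary_simplexChain, Fin.sum_univ_three, h₀, h₁, h₂, pathChain_map_edge, pathChain_map_edge,
    pathChain_map_edge]
  norm_num
  abel

theorem simplexChain_eq_pathChain (s : C(stdSimplex ℝ (Fin 2), M)) :
    simplexChain s = pathChain ((edge 0 1).map s.continuous) := by
  rw [pathChain_map_edge]
  have : (![0, 1] : Fin 2 → Fin 2) = id := by decide
  congr 1
  ext u
  simp [this]

end Edges

section OneChainsModBoundaries

variable {M N : Type u} [TopologicalSpace M] [TopologicalSpace N]

/-- Singular 1-chains modulo boundaries. This group contains `H₁(M; ℤ)` and, unlike it, also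
contains the classes of paths that are not closed. -/
abbrev OneChainsModBoundaries (M : Type u) [TopologicalSpace M] : ModuleCat.{u} ℤ :=
  (singularChains M).opcycles 1

/-- The projection of the singular 1-chains to the 1-chains modulo boundaries. -/
abbrev modBoundaries (M : Type u) [TopologicalSpace M] :
    (singularChains M).X 1 →ₗ[ℤ] OneChainsModBoundaries M :=
  ((singularChains M).pOpcycles 1).hom

/-- The inclusion of the first homology group in the 1-chains modulo boundaries. -/
abbrev homologyInclusion (M : Type u) [TopologicalSpace M] :
    H1 M →ₗ[ℤ] OneChainsModBoundaries M :=
  ((singularChains M).homologyι 1).hom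

theorem homologyInclusion_injective : Function.Injective (homologyInclusion M) :=
  (ModuleCat.mono_iff_injective ((singularChains M).homologyι 1)).1 inferInstance

theorem modBoundaries_surjective : Function.Surjective (modBoundaries M) :=
  (ModuleCat.epi_iff_surjective ((singularChains M).pOpcycles 1)).1 inferInstance

theorem modBoundaries_eq_zero_iff (c : (singularChains M).X 1) :
    modBoundaries M c = 0 ↔ ∃ e, ((singularChains M).d 2 1).hom e = c := by
  have exactness := ShortComplex.exact_of_g_is_cokernel
    (ShortComplex.mk _ _ ((singularChains M).d_pOpcycles 2 1))
    ((singularChains M).opcyclesIsCokernel 2 1 (by simp))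
  exact ⟨(ShortComplex.moduleCat_exact_iff _).1 exactness c, by
    rintro ⟨e, rfl⟩
    exact congrArg (fun φ => φ.hom e) ((singularChains M).d_pOpcycles 2 1)⟩

theorem boundary_eq_zero_of_homologyInclusion_eq {c : (singularChains M).X 1} {h : H1 M}
    (hc : homologyInclusion M h = modBoundaries M c) : ((singularChains M).d 1 0).hom c = 0 := by
  have fromOpcycles : ((singularChains M).fromOpcycles 1 0).hom (modBoundaries M c) =
      ((singularChains M).d 1 0).hom c :=
    congrArg (fun φ => φ.hom c) ((singularChains M).p_fromOpcycles 1 0)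
  rw [← fromOpcycles, ← hc]
  exact congrArg (fun φ => φ.hom h) ((singularChains M).homologyι_comp_fromOpcycles 1 0)

/-- The map induced on 1-chains modulo boundaries by a continuous map. -/
abbrev modBoundariesMap (f : C(M, N)) : OneChainsModBoundaries M →ₗ[ℤ] OneChainsModBoundaries N :=
  (HomologicalComplex.opcyclesMap (chainsMap f) 1).hom

theorem modBoundariesMap_homologyInclusion (f : C(M, M)) (h : H1 M) :
    modBoundariesMap f (homologyInclusion M h) = homologyInclusion M (H1map f h) :=
  (congrArg (fun φ => φ.hom h) (HomologicalComplex.homologyι_naturality (chainsMap f) 1)).symm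

end OneChainsModBoundaries

section PathClass

variable {M : Type u} [TopologicalSpace M] {x y z : M}

/-- The class modulo boundaries of a path, seen as a singular 1-chain. -/
def pathClass (γ : Path x y) : OneChainsModBoundaries M :=
  modBoundaries M (pathChain γ)

theorem homologousRel_iff (γ γ' : Path x y) :
    HomologousRel γ γ' ↔ pathClass γ' = pathClass γ := by
  rw [HomologousRel, ← modBoundaries_eq_zero_iff, map_sub, sub_eq_zero]
  rfl

theorem IsHomologyClass.homologyInclusion_eq {l : Path x x} {h : H1 M}
    (hl : IsHomologyClass l h) : homologyInclusion M h = pathClass l := by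
  obtain ⟨c, hc, rfl⟩ := hl
  rw [pathClass, ← hc]
  exact congrArg (fun φ => φ.hom c) ((singularChains M).homology_π_ι 1)

theorem exists_isHomologyClass (l : Path x x) : ∃ h, IsHomologyClass l h := by
  have exactness := ShortComplex.exact_of_f_is_kernel
    (ShortComplex.mk _ _ ((singularChains M).iCycles_d 1 0))
    ((singularChains M).cyclesIsKernel 1 0 (by simp))
  obtain ⟨c, hc⟩ := (ShortComplex.moduleCat_exact_iff _).1 exactness (pathChain l) (by
    change ((singularChains M).d 1 0).hom _ = 0
    rw [boundary_pathChain, sub_self])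
  exact ⟨_, c, hc, rfl⟩

theorem isHomologyClass_iff (l : Path x x) (h : H1 M) :
    IsHomologyClass l h ↔ homologyInclusion M h = pathClass l := by
  refine ⟨fun hl => hl.homologyInclusion_eq, fun hl => ?_⟩
  obtain ⟨h', hl'⟩ := exists_isHomologyClass l
  rwa [homologyInclusion_injective (hl.trans hl'.homologyInclusion_eq.symm)]

theorem pathClass_congr {x' y' : M} {γ : Path x y} {γ' : Path x' y'} (h : ∀ t, γ t = γ' t) :
    pathClass γ = pathClass γ' := by
  rw [pathClass, pathClass, pathChain_eq_simplexChain, pathChain_eq_simplexChain]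
  congr 2
  ext u
  exact h _

theorem pathClass_map {N : Type u} [TopologicalSpace N] (f : C(M, N)) (γ : Path x y) :
    pathClass (γ.map f.continuous) = modBoundariesMap f (pathClass γ) := by
  have h : modBoundariesMap f (modBoundaries M (pathChain γ)) =
      modBoundaries N (((chainsMap f).f 1).hom (pathChain γ)) :=
    congrArg (fun φ => φ.hom (pathChain γ)) (HomologicalComplex.p_opcyclesMap (chainsMap f) 1)
  rw [pathClass, pathClass, h, pathChain_eq_simplexChain γ, chainsMap_simplexChain]
  rfl

theorem pathClass_segment_add {E : Type*} [AddCommGroup E] [Module ℝ E] [TopologicalSpace E]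
    [IsTopologicalAddGroup E] [ContinuousSMul ℝ E] (g : C(E, M)) (a b c : E) :
    pathClass ((Path.segment a b).map g.continuous) +
      pathClass ((Path.segment b c).map g.continuous) =
        pathClass ((Path.segment a c).map g.continuous) := by
  let s : C(stdSimplex ℝ (Fin 3), M) := g.comp ⟨fun u => ∑ k, u k • ![a, b, c] k, by
    have (k : Fin 3) : Continuous fun u : stdSimplex ℝ (Fin 3) => u k :=
      (continuous_apply k).comp continuous_subtype_val
    exact continuous_finsetSum _ fun k _ => (this k).smul continuous_const⟩
  have edge_eq (i j : Fin 3) : pathClass ((edge i j).map s.continuous) =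
      pathClass ((Path.segment (![a, b, c] i) (![a, b, c] j)).map g.continuous) :=
    pathClass_congr fun t => congrArg g (sum_edge_smul i j t _)
  have h := (modBoundaries_eq_zero_iff _).2 ⟨_, boundary_triangle s⟩
  rw [map_sub, map_add, sub_eq_zero] at h
  change pathClass _ + pathClass _ = pathClass _ at h
  rwa [edge_eq, edge_eq, edge_eq] at h

theorem pathClass_refl (x : M) : pathClass (Path.refl x) = 0 := by
  have h := pathClass_segment_add (.const ℝ x) 0 0 0
  rw [add_eq_left] at h
  exact (pathClass_congr fun _ => rfl).trans h

theorem pathClass_trans (p : Path x y) (q : Path y z) :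
    pathClass (p.trans q) = pathClass p + pathClass q := by
  let g : C(ℝ, M) := ⟨(p.trans q).extend, (p.trans q).continuous_extend⟩
  have h := pathClass_segment_add g 0 (1 / 2) 1
  have hp : pathClass ((Path.segment (0 : ℝ) (1 / 2)).map g.continuous) = pathClass p :=
    pathClass_congr fun t => by
      have ht : AffineMap.lineMap 0 (1 / 2 : ℝ) (t : ℝ) ≤ 1 / 2 := by
        rw [AffineMap.lineMap_apply_ring']; linarith [t.2.2]
      have ht' : 2 * AffineMap.lineMap 0 (1 / 2 : ℝ) (t : ℝ) = t := by
        rw [AffineMap.lineMap_apply_ring']; ring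
      simp [g, -one_div, Path.extend_trans_of_le_half _ _ ht, ht']
  have hq : pathClass ((Path.segment (1 / 2 : ℝ) 1).map g.continuous) = pathClass q :=
    pathClass_congr fun t => by
      have ht : 1 / 2 ≤ AffineMap.lineMap (1 / 2 : ℝ) 1 (t : ℝ) := by
        rw [AffineMap.lineMap_apply_ring']; linarith [t.2.1]
      have ht' : 2 * AffineMap.lineMap (1 / 2 : ℝ) 1 (t : ℝ) - 1 = t := by
        rw [AffineMap.lineMap_apply_ring']; ring
      simp [g, -one_div, Path.extend_trans_of_half_le _ _ ht, ht']
  have hpq : pathClass ((Path.segment (0 : ℝ) 1).map g.continuous) = pathClass (p.trans q) :=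
    pathClass_congr fun t => by
      simp [g, AffineMap.lineMap_apply]
  rw [← hp, ← hq, h, hpq]

theorem pathClass_eq_of_homotopic {p q : Path x y} (h : p.Homotopic q) :
    pathClass p = pathClass q := by
  obtain ⟨F⟩ := h
  let g : C(ℝ × ℝ, M) := F.toContinuousMap.comp
    ⟨fun v => (Set.projIcc 0 1 zero_le_one v.1, Set.projIcc 0 1 zero_le_one v.2), by fun_prop⟩
  have left : pathClass ((Path.segment (0, 0) (0, 1)).map g.continuous) = pathClass p :=
    pathClass_congr fun t => by simp [g, AffineMap.lineMap_apply]
  have right : pathClass ((Path.segment (1, 0) (1, 1)).map g.continuous) = pathClass q :=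
    pathClass_congr fun t => by simp [g, AffineMap.lineMap_apply]
  have bottom : pathClass ((Path.segment (0, 0) (1, 0)).map g.continuous) = 0 :=
    (pathClass_congr fun t => by simp [g]).trans (pathClass_refl x)
  have top : pathClass ((Path.segment (0, 1) (1, 1)).map g.continuous) = 0 :=
    (pathClass_congr fun t => by simp [g]).trans (pathClass_refl y)
  -- The square is cut along its diagonal.
  have upper := pathClass_segment_add g (0, 0) (0, 1) (1, 1)
  have lower := pathClass_segment_add g (0, 0) (1, 0) (1, 1)
  rw [left, top, add_zero] at upper
  rw [bottom, right, zero_add] at lower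
  rw [upper, lower]

theorem pathClass_symm (p : Path x y) : pathClass p.symm = -pathClass p := by
  rw [eq_neg_iff_add_eq_zero, add_comm, ← pathClass_trans, ← pathClass_refl x]
  exact (pathClass_eq_of_homotopic ⟨Path.Homotopy.reflTransSymm p⟩).symm

end PathClass

section ChainClass

variable {M : Type u} [TopologicalSpace M] {x y z : M}

/-- The class modulo boundaries of a homotopy class of paths. -/
def chainClass (a : Path.Homotopic.Quotient x y) : OneChainsModBoundaries M :=
  Quotient.lift (s := Path.Homotopic.setoid x y) pathClass
    (fun _ _ h => pathClass_eq_of_homotopic h) a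

@[simp]
theorem chainClass_mk (γ : Path x y) : chainClass (.mk γ) = pathClass γ := rfl

@[simp]
theorem chainClass_refl (x : M) : chainClass (.refl x) = 0 := pathClass_refl x

@[simp]
theorem chainClass_trans (a : Path.Homotopic.Quotient x y) (b : Path.Homotopic.Quotient y z) :
    chainClass (a.trans b) = chainClass a + chainClass b := by
  induction a with | mk p => induction b with | mk q => exact pathClass_trans p q

@[simp]
theorem chainClass_symm (a : Path.Homotopic.Quotient x y) : chainClass a.symm = -chainClass a := by
  induction a with | mk p => exact pathClass_symm p

@[simp]
theorem chainClass_cast {x' y' : M} (a : Path.Homotopic.Quotient x y) (hx : x' = x) (hy : y' = y) :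
    chainClass (a.cast hx hy) = chainClass a := by
  induction a with | mk p => exact pathClass_congr fun _ => rfl

@[simp]
theorem chainClass_map {N : Type u} [TopologicalSpace N] (f : C(M, N))
    (a : Path.Homotopic.Quotient x y) :
    chainClass (a.map f) = modBoundariesMap f (chainClass a) := by
  induction a with | mk p => exact pathClass_map f p

theorem exists_homologyInclusion_eq_chainClass (a : Path.Homotopic.Quotient x x) :
    ∃ h, homologyInclusion M h = chainClass a := by
  induction a with | mk l =>
  obtain ⟨h, hl⟩ := exists_isHomologyClass l
  exact ⟨h, hl.homologyInclusion_eq⟩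

end ChainClass

section Hurewicz

variable {M : Type u} [TopologicalSpace M] (x₀ : M) {x y z : M}

/-- The Hurewicz homomorphism, with values in the 1-chains modulo boundaries. -/
def hurewicz : Additive (FundamentalGroup M x₀) →+ OneChainsModBoundaries M where
  toFun l := chainClass (FundamentalGroup.toPath l.toMul)
  map_zero' := chainClass_refl x₀
  map_add' _ _ := (chainClass_trans _ _).trans (add_comm _ _)

theorem hurewicz_eq_zero_of_mem_commutator {l : FundamentalGroup M x₀}
    (hl : l ∈ commutator (FundamentalGroup M x₀)) : hurewicz x₀ (.ofMul l) = 0 :=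
  Abelianization.commutator_subset_ker (AddMonoidHom.toMultiplicativeRight (hurewicz x₀)) hl

variable [PathConnectedSpace M]

/-- The path class `a`, closed up to a loop at `x₀` by chosen paths from `x₀` to its endpoints. -/
def basedLoop (a : Path.Homotopic.Quotient x y) : FundamentalGroup M x₀ :=
  .fromPath (((Path.Homotopic.Quotient.mk (PathConnectedSpace.somePath x₀ x)).trans a).trans
    (Path.Homotopic.Quotient.mk (PathConnectedSpace.somePath x₀ y)).symm)

theorem hurewicz_basedLoop (a : Path.Homotopic.Quotient x y) :
    hurewicz x₀ (.ofMul (basedLoop x₀ a)) = chainClass a -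
      (pathClass (PathConnectedSpace.somePath x₀ y) -
        pathClass (PathConnectedSpace.somePath x₀ x)) := by
  change chainClass ((Path.Homotopic.Quotient.trans _ a).trans _) = _
  simp only [chainClass_trans, chainClass_symm, chainClass_mk]
  abel

theorem basedLoop_trans (a : Path.Homotopic.Quotient x y) (b : Path.Homotopic.Quotient y z) :
    basedLoop x₀ (a.trans b) = basedLoop x₀ b * basedLoop x₀ a := by
  have cancel (p : Path.Homotopic.Quotient x₀ y) {w : M} (q : Path.Homotopic.Quotient y w) :
      p.symm.trans (p.trans q) = q := by
    rw [← Path.Homotopic.Quotient.trans_assoc, Path.Homotopic.Quotient.symm_trans,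
      Path.Homotopic.Quotient.refl_trans]
  simp only [basedLoop, FundamentalGroup.mul_def, FundamentalGroup.fromPath,
    FundamentalGroup.fromArrow, Path.Homotopic.Quotient.trans_assoc, cancel]

theorem abelianization_basedLoop (l : FundamentalGroup M x₀) :
    Abelianization.of (basedLoop x₀ l.toPath) = Abelianization.of l := by
  let a := FundamentalGroup.fromPath (.mk (PathConnectedSpace.somePath x₀ x₀))
  have h : basedLoop x₀ l.toPath = a⁻¹ * (l * a) := rfl
  rw [h, map_mul, map_mul, map_inv, mul_comm (Abelianization.of l), inv_mul_cancel_left]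

theorem exists_hurewicz_eq (h : H1 M) : ∃ l, hurewicz x₀ l = homologyInclusion M h := by
  obtain ⟨ψ, hψ⟩ := exists_addMonoidHom_simplexChain (M := M) (n := 0)
    fun s => pathClass (PathConnectedSpace.somePath x₀ (s (stdSimplex.vertex 0)))
  have hψ' (y : M) : ψ (pointChain y) = pathClass (PathConnectedSpace.somePath x₀ y) := hψ _
  -- Corrected by a term that depends only on its boundary, every chain is a sum of based loops.
  have mem_range (c) : modBoundaries M c - ψ (((singularChains M).d 1 0).hom c) ∈
      (hurewicz x₀).range := by
    let χ := (modBoundaries M).toAddMonoidHom -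
      ψ.comp ((singularChains M).d 1 0).hom.toAddMonoidHom
    have : (QuotientAddGroup.mk' (hurewicz x₀).range).comp χ = 0 := by
      refine addMonoidHom_ext_simplexChain fun s => (QuotientAddGroup.eq_zero_iff _).2 ?_
      refine ⟨.ofMul (basedLoop x₀ (.mk ((edge 0 1).map s.continuous))), ?_⟩
      rw [hurewicz_basedLoop, simplexChain_eq_pathChain, ← hψ', ← hψ', ← map_sub,
        ← boundary_pathChain]
      rfl
    exact (QuotientAddGroup.eq_zero_iff _).1 (DFunLike.congr_fun this c)
  obtain ⟨c, hc⟩ := modBoundaries_surjective (homologyInclusion M h)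
  obtain ⟨l, hl⟩ := mem_range c
  refine ⟨l, ?_⟩
  rw [hl, boundary_eq_zero_of_homologyInclusion_eq hc.symm, map_zero, sub_zero, hc]

theorem basedLoop_congr {x' y' : M} {p : Path x y} {q : Path x' y'} (h : ∀ t, p t = q t) :
    basedLoop x₀ (.mk p) = basedLoop x₀ (.mk q) := by
  obtain rfl : x = x' := by simpa using h 0
  obtain rfl : y = y' := by simpa using h 1
  rw [Path.ext (funext h)]

theorem exists_addMonoidHom_pathChain :
    ∃ φ : (singularChains M).X 1 →+ Additive (Abelianization (FundamentalGroup M x₀)),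
      ∀ {x y : M} (p : Path x y), φ (pathChain p) = .ofMul (.of (basedLoop x₀ (.mk p))) := by
  obtain ⟨φ, hφ⟩ := exists_addMonoidHom_simplexChain fun s : C(stdSimplex ℝ (Fin 2), M) =>
    Additive.ofMul (Abelianization.of (basedLoop x₀ (.mk ((edge 0 1).map s.continuous))))
  refine ⟨φ, fun {x y} p => ?_⟩
  rw [pathChain_eq_simplexChain, hφ, basedLoop_congr]
  intro t
  have : (![0, 1] : Fin 2 → Fin 2) = id := by decide
  change p (stdSimplexHomeomorphUnitInterval (simplexMap ![0, 1] _)) = p t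
  simp [this]

theorem map_boundary_eq_zero {φ : (singularChains M).X 1 →+
      Additive (Abelianization (FundamentalGroup M x₀))}
    (hφ : ∀ {x y : M} (p : Path x y), φ (pathChain p) = .ofMul (.of (basedLoop x₀ (.mk p))))
    (c : (singularChains M).X 2) : φ (((singularChains M).d 2 1).hom c) = 0 := by
  have : φ.comp ((singularChains M).d 2 1).hom.toAddMonoidHom = 0 := by
    refine addMonoidHom_ext_simplexChain fun s => ?_
    have homotopic : (((edge 0 1).map s.continuous).trans ((edge 1 2).map s.continuous)).Homotopic
        ((edge 0 2).map s.continuous) := by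
      rw [← Path.map_trans]
      exact (SimplyConnectedSpace.paths_homotopic _ _).map s
    refine (congrArg φ (boundary_triangle s)).trans ?_
    rw [map_sub, map_add, hφ, hφ, hφ, ← Path.Homotopic.Quotient.eq.2 homotopic,
      Path.Homotopic.Quotient.mk_trans, basedLoop_trans, map_mul, ofMul_mul]
    exact sub_eq_zero.2 (add_comm _ _)
  exact DFunLike.congr_fun this c

theorem mem_commutator_of_hurewicz_eq_zero {l : FundamentalGroup M x₀}
    (hl : hurewicz x₀ (.ofMul l) = 0) : l ∈ commutator (FundamentalGroup M x₀) := by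
  obtain ⟨φ, hφ⟩ := exists_addMonoidHom_pathChain x₀
  obtain ⟨p, hp⟩ := Path.Homotopic.Quotient.mk_surjective l.toPath
  obtain ⟨c, hc⟩ : ∃ c, ((singularChains M).d 2 1).hom c = pathChain p := by
    rw [← modBoundaries_eq_zero_iff, ← hl]
    exact congrArg chainClass hp
  rw [← Abelianization.ker_of, MonoidHom.mem_ker, ← abelianization_basedLoop, ← hp]
  exact (hφ p).symm.trans (hc ▸ map_boundary_eq_zero x₀ hφ c)

theorem exists_path_isHomologyClass (h : H1 M) : ∃ l : Path x₀ x₀, IsHomologyClass l h := by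
  obtain ⟨k, hk⟩ := exists_hurewicz_eq x₀ h
  obtain ⟨l, hl⟩ := Path.Homotopic.Quotient.mk_surjective (FundamentalGroup.toPath k.toMul)
  exact ⟨l, (isHomologyClass_iff l h).2 (hk.symm.trans (congrArg chainClass hl.symm))⟩

end Hurewicz

section LocalTopology

/-- Semilocal simple connectedness, with homology in place of homotopy: every point has a
neighbourhood in which paths with the same endpoints are homologous in the whole space. Lifts to
the universal Abelian cover are then determined by their value at one point. -/
def SemilocallyHomologyTrivial (M : Type u) [TopologicalSpace M] : Prop :=
  ∀ y : M, ∃ U : Set M, IsOpen U ∧ y ∈ U ∧ ∀ ⦃a b : M⦄ (p q : Path a b),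
    (∀ t, p t ∈ U) → (∀ t, q t ∈ U) → HomologousRel p q

theorem semilocallyHomologyTrivial_of_stronglyLocallyContractibleSpace (M : Type u)
    [TopologicalSpace M] [StronglyLocallyContractibleSpace M] : SemilocallyHomologyTrivial M := by
  intro y
  obtain ⟨S, hS, _⟩ := (contractible_basis y).ex_mem
  refine ⟨interior S, isOpen_interior, mem_interior_iff_mem_nhds.2 hS, fun a b p q hp hq => ?_⟩
  have ha : a ∈ S := interior_subset (p.source ▸ hp 0)
  have hb : b ∈ S := interior_subset (p.target ▸ hp 1)
  let restrict (r : Path a b) (hr : ∀ t, r t ∈ interior S) : Path (⟨a, ha⟩ : S) ⟨b, hb⟩ :=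
    { toFun := fun t => ⟨r t, interior_subset (hr t)⟩
      source' := Subtype.ext r.source
      target' := Subtype.ext r.target }
  rw [homologousRel_iff]
  exact (pathClass_eq_of_homotopic ((SimplyConnectedSpace.paths_homotopic (restrict p hp)
    (restrict q hq)).map ⟨Subtype.val, continuous_subtype_val⟩)).symm

variable {H : Type*} [TopologicalSpace H]

theorem stronglyLocallyContractibleSpace_of_modelWithCorners {E : Type*} [NormedAddCommGroup E]
    [NormedSpace ℝ E] (I : ModelWithCorners ℝ E H) : StronglyLocallyContractibleSpace H := by
  refine .of_bases (fun h => I.isClosedEmbedding.nhds_eq_comap h ▸ Metric.nhds_basis_ball.comap I)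
    fun h r hr => ?_
  have convex : Convex ℝ (I '' (I ⁻¹' Metric.ball (I h) r)) := by
    rw [Set.image_preimage_eq_inter_range]
    exact (convex_ball _ _).inter I.convex_range
  have := convex.contractibleSpace ⟨_, h, Metric.mem_ball_self hr, rfl⟩
  exact (I.isClosedEmbedding.isEmbedding.homeomorphImage _).contractibleSpace

theorem stronglyLocallyContractibleSpace_of_chartedSpace (H : Type*) [TopologicalSpace H]
    [StronglyLocallyContractibleSpace H] (M : Type*) [TopologicalSpace M] [ChartedSpace H M] :
    StronglyLocallyContractibleSpace M := by
  refine .of_bases (fun y => ?_) (s := fun y S => (chartAt H y).symm '' S)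
    (p := fun y S => (S ∈ nhds (chartAt H y y) ∧ ContractibleSpace S) ∧ S ⊆ (chartAt H y).target)
    ?_
  · simpa only [OpenPartialHomeomorph.symm_map_nhds_eq, mem_chart_source, id] using
      ((contractible_basis (chartAt H y y)).restrict_subset
        ((chartAt H y).open_target.mem_nhds (mem_chart_target H y))).map (chartAt H y).symm
  · rintro y S ⟨⟨-, _⟩, hS⟩
    exact ((chartAt H y).symm.homeomorphOfImageSubsetSource hS rfl).symm.contractibleSpace

end LocalTopology

section UniversalCover

variable {M : Type u} [TopologicalSpace M] {x₀ : M}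

theorem forall_trans_mem {x y z : M} {p : Path x y} {q : Path y z} {U : Set M}
    (hp : ∀ t, p t ∈ U) (hq : ∀ t, q t ∈ U) (t : unitInterval) : p.trans q t ∈ U := by
  rw [Path.trans_apply]
  split_ifs
  exacts [hp _, hq _]

theorem homotopyQuotient_map_trans {N : Type*} [TopologicalSpace N] (f : C(M, N)) {x y z : M}
    (a : Path.Homotopic.Quotient x y) (b : Path.Homotopic.Quotient y z) :
    (a.trans b).map f = (a.map f).trans (b.map f) := by
  induction a with | mk p => induction b with | mk q =>
  exact congrArg Path.Homotopic.Quotient.mk (Path.map_trans p q f.continuous)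

namespace UniversalCover

theorem isOpen_sheet (a : UniversalCover x₀) {U : Set M} (hU : IsOpen U) (ha : a.endpoint ∈ U) :
    IsOpen (a.sheet U) :=
  TopologicalSpace.isOpen_generateFrom_of_mem ⟨a, U, hU, ha, rfl⟩

theorem mem_sheet_self (a : UniversalCover x₀) {U : Set M} (ha : a.endpoint ∈ U) :
    a ∈ a.sheet U :=
  ⟨Path.refl _, fun _ => ha, (Path.Homotopic.Quotient.trans_refl _).symm⟩

theorem endpoint_mem_of_mem_sheet {a b : UniversalCover x₀} {U : Set M} (h : b ∈ a.sheet U) :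
    b.endpoint ∈ U := by
  obtain ⟨η, hη, -⟩ := h
  simpa using hη 1

theorem sheet_subset_sheet {a b : UniversalCover x₀} {U : Set M} (h : b ∈ a.sheet U) :
    b.sheet U ⊆ a.sheet U := by
  obtain ⟨η, hη, hb⟩ := h
  rintro d ⟨ζ, hζ, hd⟩
  refine ⟨η.trans ζ, forall_trans_mem hη hζ, ?_⟩
  rw [hd, hb, Path.Homotopic.Quotient.trans_assoc, Path.Homotopic.Quotient.mk_trans]

theorem continuous_of_eventually_mem_sheet {X : Type*} [TopologicalSpace X]
    {g : X → UniversalCover x₀} (h : ∀ (x : X) (U : Set M), IsOpen U → (g x).endpoint ∈ U →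
      ∀ᶠ y in nhds x, g y ∈ (g x).sheet U) : Continuous g := by
  refine continuous_generateFrom_iff.2 ?_
  rintro _ ⟨a, U, hU, -, rfl⟩
  exact isOpen_iff_mem_nhds.2 fun x hx => (h x U hU (endpoint_mem_of_mem_sheet hx)).mono
    fun _ hy => sheet_subset_sheet hx hy

/-- The map `[α] ↦ [c · f α]` of the universal cover. -/
def lift (f : C(M, M)) (c : Path.Homotopic.Quotient x₀ (f x₀)) (a : UniversalCover x₀) :
    UniversalCover x₀ :=
  ⟨f a.endpoint, c.trans (a.cls.map f)⟩

theorem continuous_lift (f : C(M, M)) (c : Path.Homotopic.Quotient x₀ (f x₀)) :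
    Continuous (lift f c) := by
  refine continuous_of_eventually_mem_sheet fun a U hU ha => ?_
  filter_upwards [(a.isOpen_sheet (hU.preimage f.continuous) ha).mem_nhds (a.mem_sheet_self ha)]
  rintro b ⟨η, hη, hb⟩
  refine ⟨η.map f.continuous, hη, ?_⟩
  change c.trans (b.cls.map f) = _
  rw [hb, homotopyQuotient_map_trans, ← Path.Homotopic.Quotient.trans_assoc]
  rfl

theorem continuous_mk_subpath {x y : M} (α : Path x y) : Continuous fun t : unitInterval =>
    (⟨α t, .mk (α.subpath 0 t)⟩ : UniversalCover (α 0)) := by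
  refine continuous_of_eventually_mem_sheet fun t U hU ht => ?_
  have uIcc_subset : ∀ᶠ s in nhds t, Set.uIcc t s ⊆ α ⁻¹' U :=
    (tendsto_const_nhds.uIcc Filter.tendsto_id).eventually
      (Filter.eventually_smallSets_subset.2 ((hU.preimage α.continuous).mem_nhds ht))
  filter_upwards [uIcc_subset] with s hs
  refine ⟨α.subpath t s, fun r => ?_, ?_⟩
  · have : α.subpath t s r ∈ α '' Set.uIcc t s := α.range_subpath t s ▸ Set.mem_range_self r
    exact Set.image_subset_iff.2 hs this
  · exact (Path.Homotopic.Quotient.eq.2 ⟨Path.Homotopy.subpathTransSubpath α 0 t s⟩).symm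

theorem joined_mk_refl (a : UniversalCover x₀) : Joined ⟨x₀, .refl x₀⟩ a := by
  obtain ⟨y, a⟩ := a
  induction a with | mk α =>
  obtain ⟨α, rfl, rfl⟩ := α
  let β : Path (α 0) (α 1) := ⟨α, rfl, rfl⟩
  refine ⟨⟨⟨_, continuous_mk_subpath β⟩, ?_, ?_⟩⟩
  · exact congrArg (fun p => UniversalCover.mk _ (.mk p)) (β.subpath_self 0)
  · exact congrArg (fun p => UniversalCover.mk _ (.mk p)) β.subpath_zero_one

instance : PathConnectedSpace (UniversalCover x₀) :=
  ⟨⟨⟨x₀, .refl x₀⟩⟩, fun a b => (joined_mk_refl a).symm.trans (joined_mk_refl b)⟩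

end UniversalCover

end UniversalCover

section AbelianCover

variable {M : Type u} [TopologicalSpace M] {x₀ : M}

namespace AbelianCover

/-- The point of the universal Abelian cover given by a homotopy class of paths. -/
def mk {y : M} (a : Path.Homotopic.Quotient x₀ y) : AbelianCover x₀ :=
  Quotient.mk (commutatorSetoid x₀) ⟨y, a⟩

theorem exists_eq_mk (e : AbelianCover x₀) :
    ∃ (y : M) (a : Path.Homotopic.Quotient x₀ y), e = mk a := by
  obtain ⟨⟨y, a⟩, rfl⟩ := Quotient.exists_rep e
  exact ⟨y, a, rfl⟩

theorem exists_mk_eq_of_proj_eq {e : AbelianCover x₀} {y : M} (h : e.proj = y) :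
    ∃ a : Path.Homotopic.Quotient x₀ y, mk a = e := by
  obtain ⟨z, a, rfl⟩ := exists_eq_mk e
  obtain rfl : z = y := h
  exact ⟨a, rfl⟩

/-- The class modulo boundaries of the paths that represent a point of the universal Abelian
cover. It tells the points of a fibre apart. -/
def fiberClass (e : AbelianCover x₀) : OneChainsModBoundaries M :=
  Quotient.lift (s := commutatorSetoid x₀) (fun a => chainClass a.cls) (by
    rintro a b ⟨l, hl, rfl⟩
    have h : chainClass l.toPath = 0 := hurewicz_eq_zero_of_mem_commutator x₀ hl
    simp [UniversalCover.act, h]) e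

@[simp]
theorem proj_mk {y : M} (a : Path.Homotopic.Quotient x₀ y) : (mk a).proj = y := rfl

@[simp]
theorem fiberClass_mk {y : M} (a : Path.Homotopic.Quotient x₀ y) :
    (mk a).fiberClass = chainClass a := rfl

@[simp]
theorem proj_deck (l : FundamentalGroup M x₀) (e : AbelianCover x₀) :
    (deck l e).proj = e.proj := by
  obtain ⟨y, a, rfl⟩ := exists_eq_mk e
  rfl

@[simp]
theorem fiberClass_deck (l : FundamentalGroup M x₀) (e : AbelianCover x₀) :
    (deck l e).fiberClass = hurewicz x₀ (.ofMul l) + e.fiberClass := by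
  obtain ⟨y, a, rfl⟩ := exists_eq_mk e
  exact chainClass_trans l.toPath a

theorem exists_fiberClass_sub_eq {e e' : AbelianCover x₀} (h : e.proj = e'.proj) :
    ∃ g, homologyInclusion M g = e'.fiberClass - e.fiberClass := by
  obtain ⟨y, a, rfl⟩ := exists_eq_mk e
  obtain ⟨a', rfl⟩ := exists_mk_eq_of_proj_eq (y := y) h.symm
  obtain ⟨g, hg⟩ := exists_homologyInclusion_eq_chainClass (a'.trans a.symm)
  exact ⟨g, by simp [hg, sub_eq_add_neg]⟩

/-- The analogue of `UniversalCover.sheet` for homology: the points reached from `e` along the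
homology classes of paths in `U`. -/
def sheet (e : AbelianCover x₀) (U : Set M) : Set (AbelianCover x₀) :=
  {e' | ∃ η : Path e.proj e'.proj, (∀ t, η t ∈ U) ∧ e'.fiberClass = e.fiberClass + pathClass η}

theorem mem_sheet_self (e : AbelianCover x₀) {U : Set M} (he : e.proj ∈ U) : e ∈ e.sheet U :=
  ⟨Path.refl _, fun _ => he, by rw [pathClass_refl, add_zero]⟩

theorem isOpen_sheet (e : AbelianCover x₀) {U : Set M} (hU : IsOpen U) : IsOpen (e.sheet U) := by
  refine isOpen_coinduced.2 ?_
  change IsOpen {b : UniversalCover x₀ | ∃ η : Path e.proj b.endpoint, (∀ t, η t ∈ U) ∧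
    chainClass b.cls = e.fiberClass + pathClass η}
  refine isOpen_iff_forall_mem_open.2 ?_
  rintro b ⟨η, hη, hb⟩
  have hbU : b.endpoint ∈ U := η.target ▸ hη 1
  refine ⟨b.sheet U, ?_, b.isOpen_sheet hU hbU, b.mem_sheet_self hbU⟩
  rintro d ⟨ζ, hζ, hd⟩
  refine ⟨η.trans ζ, forall_trans_mem hη hζ, ?_⟩
  rw [hd, chainClass_trans, hb, chainClass_mk, pathClass_trans, add_assoc]

instance : PathConnectedSpace (AbelianCover x₀) :=
  inferInstanceAs (PathConnectedSpace (Quotient (commutatorSetoid x₀)))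

variable [PathConnectedSpace M]

theorem ext {e e' : AbelianCover x₀} (hproj : e.proj = e'.proj)
    (hclass : e.fiberClass = e'.fiberClass) : e = e' := by
  obtain ⟨y, a, rfl⟩ := exists_eq_mk e
  obtain ⟨b, rfl⟩ := exists_mk_eq_of_proj_eq (y := y) hproj.symm
  refine Quotient.sound ⟨FundamentalGroup.fromPath (b.trans a.symm),
    mem_commutator_of_hurewicz_eq_zero x₀ ?_, ?_⟩
  · rw [fiberClass_mk, fiberClass_mk] at hclass
    change chainClass (b.trans a.symm) = 0
    simp [hclass]
  · change _ = (⟨_, (b.trans a.symm).trans a⟩ : UniversalCover x₀)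
    simp

/-- The lift `[α] ↦ [c · f α]` of `f` to the universal Abelian cover. -/
def lift (f : C(M, M)) (c : Path.Homotopic.Quotient x₀ (f x₀)) :
    C(AbelianCover x₀, AbelianCover x₀) where
  toFun := Quotient.map' (s₁ := commutatorSetoid x₀) (s₂ := commutatorSetoid x₀)
    (UniversalCover.lift f c) (by
      rintro a b ⟨l, hl, rfl⟩
      have h : chainClass l.toPath = 0 := hurewicz_eq_zero_of_mem_commutator x₀ hl
      refine Quotient.exact (ext (e := mk (c.trans (a.cls.map f)))
        (e' := mk (c.trans ((l.toPath.trans a.cls).map f))) rfl ?_)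
      simp [h])
  continuous_toFun := (UniversalCover.continuous_lift f c).quotient_map' _

theorem isLift_lift (f : C(M, M)) (c : Path.Homotopic.Quotient x₀ (f x₀)) :
    IsLift f (lift f c) := fun e => by
  obtain ⟨y, a, rfl⟩ := exists_eq_mk e
  rfl

theorem fiberClass_lift (f : C(M, M)) (c : Path.Homotopic.Quotient x₀ (f x₀))
    (e : AbelianCover x₀) :
    (lift f c e).fiberClass = chainClass c + modBoundariesMap f e.fiberClass := by
  obtain ⟨y, a, rfl⟩ := exists_eq_mk e
  exact (chainClass_trans c (a.map f)).trans (by rw [chainClass_map, fiberClass_mk])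

theorem isLocallyInjective_proj (hM : SemilocallyHomologyTrivial M) :
    IsLocallyInjective (proj (x₀ := x₀)) := by
  intro e
  obtain ⟨U, hU, heU, homologous⟩ := hM e.proj
  refine ⟨e.sheet U, e.isOpen_sheet hU, e.mem_sheet_self heU, ?_⟩
  rintro e₁ ⟨η, hη, h₁⟩ e₂ ⟨ζ, hζ, h₂⟩ h
  refine ext h ?_
  rw [h₁, h₂, ← (homologousRel_iff _ _).1 (homologous η (ζ.cast rfl h) hη hζ)]
  rfl

theorem isSeparatedMap_proj (hM : SemilocallyHomologyTrivial M) :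
    IsSeparatedMap (proj (x₀ := x₀)) := by
  intro e e' h hne
  obtain ⟨U, hU, heU, homologous⟩ := hM e.proj
  refine ⟨e.sheet U, e'.sheet U, e.isOpen_sheet hU, e'.isOpen_sheet hU, e.mem_sheet_self heU,
    e'.mem_sheet_self (h ▸ heU), Set.disjoint_left.2 ?_⟩
  rintro d ⟨η, hη, hd⟩ ⟨ζ, hζ, hd'⟩
  refine hne (ext h (add_right_cancel (b := pathClass η) ?_))
  rw [← hd, hd', ← (homologousRel_iff _ _).1 (homologous η (ζ.cast h rfl) hη hζ)]
  rfl

end AbelianCover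

theorem IsLift.exists_fiberClass_eq [PathConnectedSpace M] (hM : SemilocallyHomologyTrivial M)
    {f : C(M, M)} {F : C(AbelianCover x₀, AbelianCover x₀)} (hF : IsLift f F) :
    ∃ κ, ∀ e, (F e).fiberClass = κ + modBoundariesMap f e.fiberClass := by
  let e₀ : AbelianCover x₀ := .mk (.refl x₀)
  obtain ⟨y, c, hc⟩ := AbelianCover.exists_eq_mk (F e₀)
  obtain rfl : f x₀ = y := (hF e₀).symm.trans (congrArg AbelianCover.proj hc)
  have comp_eq : AbelianCover.proj ∘ F = AbelianCover.proj ∘ AbelianCover.lift f c :=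
    funext fun e => (hF e).trans (AbelianCover.isLift_lift f c e).symm
  have eq_lift : ⇑F = AbelianCover.lift f c :=
    (AbelianCover.isSeparatedMap_proj hM).eq_of_comp_eq (AbelianCover.isLocallyInjective_proj hM)
      F.continuous (AbelianCover.lift f c).continuous comp_eq e₀ <|
        AbelianCover.ext (congrFun comp_eq e₀) (by simp [AbelianCover.fiberClass_lift, hc, e₀])
  exact ⟨chainClass c, fun e => by rw [eq_lift, AbelianCover.fiberClass_lift]⟩

end AbelianCover

section Displacement

variable {M : Type u} [TopologicalSpace M] {b : ℕ} (Γ : Module.Basis (Fin b) ℤ (H1 M))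
  {f : C(M, M)} {x₀ x x' : M}

theorem sum_zsmul_eq_equivFun_symm (n : Fin b → ℤ) :
    ∑ i, n i • Γ i = Γ.equivFun.symm n := by
  rw [Module.Basis.equivFun_symm_apply]
  exact Finset.sum_congr rfl fun i _ => (int_smul_eq_zsmul (H1 M).isModule (n i) (Γ i)).symm

theorem equivFun_symm_homologyMatrix_sub_one_mulVec (m : Fin b → ℤ) :
    Γ.equivFun.symm ((homologyMatrix Γ f - 1).mulVec m) =
      H1map f (Γ.equivFun.symm m) - Γ.equivFun.symm m := by
  have h := LinearMap.toMatrix_mulVec_repr Γ Γ (H1map f) (Γ.equivFun.symm m)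
  rw [← Module.Basis.equivFun_apply, ← Module.Basis.equivFun_apply,
    LinearEquiv.apply_symm_apply] at h
  rw [Matrix.sub_mulVec, Matrix.one_mulVec, map_sub, homologyMatrix, h,
    LinearEquiv.symm_apply_apply]

theorem mem_imageAsubI_iff (n : Fin b → ℤ) :
    n ∈ imageAsubI Γ f ↔ ∃ h, Γ.equivFun.symm n = H1map f h - h := by
  rw [imageAsubI, LinearMap.mem_range, Γ.equivFun.symm.surjective.exists]
  refine exists_congr fun m => ?_
  rw [← equivFun_symm_homologyMatrix_sub_one_mulVec, Γ.equivFun.symm.injective.eq_iff,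
    Matrix.mulVecLin_apply, eq_comm]

variable {Γ} in
theorem IsDeckTransformation.proj_eq {n : Fin b → ℤ} {δ : AbelianCover x₀ → AbelianCover x₀}
    (hδ : IsDeckTransformation Γ n δ) (e : AbelianCover x₀) : (δ e).proj = e.proj := by
  obtain ⟨l, -, rfl⟩ := hδ
  exact AbelianCover.proj_deck _ e

variable {Γ} in
theorem IsDeckTransformation.fiberClass_eq {n : Fin b → ℤ}
    {δ : AbelianCover x₀ → AbelianCover x₀} (hδ : IsDeckTransformation Γ n δ)
    (e : AbelianCover x₀) :
    (δ e).fiberClass = homologyInclusion M (Γ.equivFun.symm n) + e.fiberClass := by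
  obtain ⟨l, hl, rfl⟩ := hδ
  rw [AbelianCover.fiberClass_deck, ← sum_zsmul_eq_equivFun_symm, hl.homologyInclusion_eq]
  rfl

theorem homologousRel_map_iff (hx : f x = x) (hx' : f x' = x') (γ : Path x x') :
    HomologousRel γ ((γ.map f.continuous).cast hx.symm hx'.symm) ↔
      modBoundariesMap f (pathClass γ) = pathClass γ := by
  have hcast := pathClass_congr (γ := (γ.map f.continuous).cast hx.symm hx'.symm)
    (γ' := γ.map f.continuous) fun _ => rfl
  rw [homologousRel_iff, ← pathClass_map, hcast]

variable [PathConnectedSpace M]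

theorem exists_isDeckTransformation (x₀ : M) (n : Fin b → ℤ) :
    ∃ δ : AbelianCover x₀ → AbelianCover x₀, IsDeckTransformation Γ n δ := by
  obtain ⟨l, hl⟩ := exists_path_isHomologyClass x₀ (∑ i, n i • Γ i)
  exact ⟨_, l, hl, rfl⟩

theorem exists_path_pathClass_eq (p : Path x x') (h : H1 M) :
    ∃ γ : Path x x', pathClass γ = homologyInclusion M h + pathClass p := by
  obtain ⟨l, hl⟩ := exists_path_isHomologyClass x h
  exact ⟨l.trans p, by rw [pathClass_trans, hl.homologyInclusion_eq]⟩

theorem IsLift.isDisplacement_iff (hM : SemilocallyHomologyTrivial M)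
    {F : C(AbelianCover x₀, AbelianCover x₀)} (hF : IsLift f F) (hx : f x = x)
    {e : AbelianCover x₀} (he : e.proj = x) (d : BF1 Γ f) :
    IsDisplacement Γ f F x d ↔ ∃ n, (imageAsubI Γ f).mkQ n = d ∧
      (F e).fiberClass = homologyInclusion M (Γ.equivFun.symm n) + e.fiberClass := by
  refine ⟨fun hd => ?_, ?_⟩
  · obtain ⟨n, δ, hδ, hFe, hn⟩ := hd e he
    exact ⟨n, hn, hFe ▸ hδ.fiberClass_eq e⟩
  · rintro ⟨n, rfl, hn⟩ e' he'
    obtain ⟨κ, hκ⟩ := hF.exists_fiberClass_eq hM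
    obtain ⟨h, hh⟩ := AbelianCover.exists_fiberClass_sub_eq (he.trans he'.symm)
    obtain ⟨m, hm⟩ := Γ.equivFun.symm.surjective (H1map f h - h)
    obtain ⟨δ, hδ⟩ := exists_isDeckTransformation Γ x₀ (n + m)
    refine ⟨n + m, δ, hδ, AbelianCover.ext ?_ ?_, ?_⟩
    · rw [hF, hδ.proj_eq, he', hx]
    · rw [hκ] at hn
      rw [hκ, hδ.fiberClass_eq, map_add, hm, map_add, map_sub,
        ← modBoundariesMap_homologyInclusion, hh, map_sub, ← sub_eq_iff_eq_add.2 hn]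
      abel
    · rw [map_add, add_eq_left, Submodule.mkQ_apply, Submodule.Quotient.mk_eq_zero]
      exact (mem_imageAsubI_iff Γ m).2 ⟨h, hm⟩

theorem IsLift.exists_homologousRel_of_isDisplacement (hM : SemilocallyHomologyTrivial M)
    {F : C(AbelianCover x₀, AbelianCover x₀)} (hF : IsLift f F) (hx : f x = x) (hx' : f x' = x')
    {d : BF1 Γ f} (hd : IsDisplacement Γ f F x d) (hd' : IsDisplacement Γ f F x' d) :
    ∃ γ : Path x x', HomologousRel γ ((γ.map f.continuous).cast hx.symm hx'.symm) := by
  let a : Path.Homotopic.Quotient x₀ x := .mk (PathConnectedSpace.somePath x₀ x)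
  let p := PathConnectedSpace.somePath x x'
  obtain ⟨κ, hκ⟩ := hF.exists_fiberClass_eq hM
  obtain ⟨n, rfl, hn⟩ := (hF.isDisplacement_iff Γ hM hx (AbelianCover.proj_mk a) d).1 hd
  obtain ⟨n', hnn', hn'⟩ :=
    (hF.isDisplacement_iff Γ hM hx' (AbelianCover.proj_mk (a.trans (.mk p))) _).1 hd'
  obtain ⟨h, hh⟩ := (mem_imageAsubI_iff Γ _).1 ((Submodule.Quotient.eq _).1 hnn')
  obtain ⟨γ, hγ⟩ := exists_path_pathClass_eq p (-h)
  refine ⟨γ, (homologousRel_map_iff hx hx' γ).2 ?_⟩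
  replace hh := congrArg (homologyInclusion M) hh
  rw [map_sub, map_sub, map_sub, ← modBoundariesMap_homologyInclusion] at hh
  simp only [hκ, AbelianCover.fiberClass_mk, chainClass_trans, chainClass_mk, map_add] at hn hn'
  rw [hγ, map_neg, map_add, map_neg]
  linear_combination (norm := module) hn' - hn + hh

theorem exists_isLift_of_homologousRel (x₀ : M) (hx : f x = x) (hx' : f x' = x') {γ : Path x x'}
    (hγ : HomologousRel γ ((γ.map f.continuous).cast hx.symm hx'.symm)) :
    ∃ F : C(AbelianCover x₀, AbelianCover x₀), IsLift f F ∧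
      ∃ e e' : AbelianCover x₀, e.proj = x ∧ e'.proj = x' ∧ F e = e ∧ F e' = e' := by
  let a : Path.Homotopic.Quotient x₀ x := .mk (PathConnectedSpace.somePath x₀ x)
  let c := a.trans ((a.map f).cast rfl hx.symm).symm
  rw [homologousRel_map_iff hx hx'] at hγ
  refine ⟨AbelianCover.lift f c, AbelianCover.isLift_lift f c, .mk a, .mk (a.trans (.mk γ)),
    rfl, rfl, AbelianCover.ext hx ?_, AbelianCover.ext hx' ?_⟩ <;>
  simp [AbelianCover.fiberClass_lift, c, hγ]

theorem IsLift.isDisplacement_zero (hM : SemilocallyHomologyTrivial M)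
    {F : C(AbelianCover x₀, AbelianCover x₀)} (hF : IsLift f F) (hx : f x = x)
    {e : AbelianCover x₀} (he : e.proj = x) (hFe : F e = e) : IsDisplacement Γ f F x 0 :=
  (hF.isDisplacement_iff Γ hM hx he 0).2 ⟨0, map_zero _, by rw [hFe, map_zero, map_zero, zero_add]⟩

end Displacement

end

end AbelianDisplacement

theorem mainTheorem7_general {M : Type u} [TopologicalSpace M] [PathConnectedSpace M]
    (hM : AbelianDisplacement.SemilocallyHomologyTrivial M)
    {b : ℕ} (Γ : Module.Basis (Fin b) ℤ (AbelianDisplacement.H1 M))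
    (x₀ : M) (f : C(M, M)) (x x' : M) (hx : f x = x) (hx' : f x' = x') :
    List.TFAE [
      ∃ F : C(AbelianDisplacement.AbelianCover x₀, AbelianDisplacement.AbelianCover x₀),
        AbelianDisplacement.IsLift f F ∧
        ∃ d : AbelianDisplacement.BF1 Γ f,
          AbelianDisplacement.IsDisplacement Γ f F x d ∧
          AbelianDisplacement.IsDisplacement Γ f F x' d,
      ∃ F : C(AbelianDisplacement.AbelianCover x₀, AbelianDisplacement.AbelianCover x₀),
        AbelianDisplacement.IsLift f F ∧
        ∃ e e' : AbelianDisplacement.AbelianCover x₀,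
          e.proj = x ∧ e'.proj = x' ∧ F e = e ∧ F e' = e',
      ∃ γ : Path x x',
        AbelianDisplacement.HomologousRel γ ((γ.map f.continuous).cast hx.symm hx'.symm)] := by
  open AbelianDisplacement in
  tfae_have 1 → 3 := fun ⟨F, hF, d, hd, hd'⟩ =>
    hF.exists_homologousRel_of_isDisplacement Γ hM hx hx' hd hd'
  tfae_have 3 → 2 := fun ⟨γ, hγ⟩ => exists_isLift_of_homologousRel x₀ hx hx' hγ
  tfae_have 2 → 1 := fun ⟨F, hF, e, e', he, he', hFe, hFe'⟩ =>
    ⟨F, hF, 0, hF.isDisplacement_zero Γ hM hx he hFe, hF.isDisplacement_zero Γ hM hx' he' hFe'⟩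
  tfae_finish

theorem mainTheorem7 {E H : Type*} [NormedAddCommGroup E] [NormedSpace ℝ E]
    [FiniteDimensional ℝ E] [TopologicalSpace H] (I : ModelWithCorners ℝ E H)
    {M : Type u} [TopologicalSpace M] [T2Space M] [CompactSpace M] [ConnectedSpace M]
    [ChartedSpace H M] [IsManifold I ∞ M]
    {b : ℕ} (Γ : Module.Basis (Fin b) ℤ (AbelianDisplacement.H1 M))
    (x₀ : M) (f : C(M, M)) (x x' : M) (hx : f x = x) (hx' : f x' = x') :
    List.TFAE [
      -- equal displacements with respect to some lift of `f`
      ∃ F : C(AbelianDisplacement.AbelianCover x₀, AbelianDisplacement.AbelianCover x₀),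
        AbelianDisplacement.IsLift f F ∧
        ∃ d : AbelianDisplacement.BF1 Γ f,
          AbelianDisplacement.IsDisplacement Γ f F x d ∧
          AbelianDisplacement.IsDisplacement Γ f F x' d,
      -- some lift of `f` fixes lifts of both points
      ∃ F : C(AbelianDisplacement.AbelianCover x₀, AbelianDisplacement.AbelianCover x₀),
        AbelianDisplacement.IsLift f F ∧
        ∃ e e' : AbelianDisplacement.AbelianCover x₀,
          e.proj = x ∧ e'.proj = x' ∧ F e = e ∧ F e' = e',
      -- some arc from `x` to `x'` is homologous to its image rel endpoints
      ∃ γ : Path x x',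
        AbelianDisplacement.HomologousRel γ ((γ.map f.continuous).cast hx.symm hx'.symm)] := by
  open AbelianDisplacement in
  have := stronglyLocallyContractibleSpace_of_modelWithCorners I
  have := stronglyLocallyContractibleSpace_of_chartedSpace H M
  have : PathConnectedSpace M := pathConnectedSpace_iff_connectedSpace.2 inferInstance
  exact mainTheorem7_general (semilocallyHomologyTrivial_of_stronglyLocallyContractibleSpace M)
    Γ x₀ f x x' hx hx'
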